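/- Let $p$ be a prime power and consider a (stationary) memoryless channel with input alphabet $\mathbb F_p$ and an arbitrary measurable output space $\mathcal Y$, specified by conditional probability mass or density functions $P_{Y|X}(\cdot\mid x)$, $x\in\mathbb F_p$, with respect to a $\sigma$-finite measure on $\mathcal Y$. Let $I(X;Y)$ be the mutual information, in base-$p$ logarithms, for $X$ uniform on $\mathbb F_p$. For a primitive polynomial $f\in\mathbb F_p[x]$ of degree $m$ with root $\alpha$, let $q=p^m$, $\mathbb F_q=\mathbb F_p[x]/(f)$, and let $\phi:\mathbb F_p^m\to\mathbb F_q$, $\phi(b)=\sum_{j<m}b_j\alpha^j$, be extended componentwise to vectors. For $0<k<n\le q-1$, exponents $0\le s_0,\dots,s_{n-1}<q-1$ and a shift $\boldsymbol a\in\mathbb F_q^n$, the generalized Reed–Solomon (coset) code of length $n$ and dimension $k$ is $\{\boldsymbol u\mathbf G+\boldsymbol a:\boldsymbol u\in\mathbb F_q^k\}$, where $\mathbf G$ is the $k\times n$ matrix with entries $\mathbf G_{i,t}=\alpha^{s_t}\alpha^{it}$ ($0\le i<k$, $0\le t<n$). Its $p$-ary image encodes a message $\boldsymbol v\in\mathbb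 F_p^K$, $K=km$, into $\boldsymbol x=\phi^{-1}(\phi(\boldsymbol v)\mathbf G+\boldsymbol a)\in\mathbb F_p^N$, $N=nm$. The frame error rate (FER) is $\Pr\{\hat{\boldsymbol V}\ne\boldsymbol V\}$, where $\boldsymbol V$ is uniform on $\mathbb F_p^K$, its encoding is transmitted over the channel, and $\hat{\boldsymbol V}$ is the output of a maximum-likelihood decoder. **Theorem.** Let $0<R<I(X;Y)$ and $\varepsilon>0$. Then over every sufficiently large field there is a generalized RS code as required: there is $m_0$ such that for every primitive polynomial $f\in\mathbb F_p[x]$ of degree $m\ge m_0$ there exist $n$, $k$ with $0<k<n\le p^m-1$, exponents $s_t$ and a shift $\boldsymbol a$ such that the $p$-ary image of the corresponding generalized RS (coset) code satisfies $K/N\ge R$ and has $\mathrm{FER}\le\varepsilon$ under maximum-likelihood decoding, however ties are broken. -/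

import Mathlib

open Polynomial MeasureTheory
open scoped NNReal ENNReal

noncomputable section

namespace GRS

/-- A stationary memoryless channel with input alphabet `F` and output space `Y`, given by its
conditional probability densities with respect to a σ-finite reference measure. The counting
measure gives discrete channels (`density` is then a probability mass function), the Lebesgue
measure gives channels with continuous output. -/
structure MemorylessChannel (F Y : Type*) [MeasurableSpace Y] where
  ref : Measure Y
  sigmaFinite_ref : SigmaFinite ref
  density : F → Y → ℝ≥0
  measurable_density : ∀ x, Measurable (density x)
  lintegral_density : ∀ x, ∫⁻ y, (density x y : ℝ≥0∞) ∂ref = 1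

namespace MemorylessChannel

variable {F Y : Type*} [MeasurableSpace Y] (W : MemorylessChannel F Y)

/-- The density of the channel output under the uniform input distribution. -/
def outputDensity [Fintype F] (y : Y) : ℝ :=
  (∑ x, (W.density x y : ℝ)) / Fintype.card F

/-- The mutual information `I(X;Y)` under uniform input, with logarithms to the base `|F|`
(that is, in `|F|`-ary symbols per channel use). The integrand is integrable for every channel;
the value `0` of `0 * logb _ 0` is the usual convention. -/
def mutualInfo [Fintype F] : ℝ :=
  ∑ x : F, (1 / (Fintype.card F : ℝ)) *
    ∫ y, (W.density x y : ℝ) *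
      Real.logb (Fintype.card F) (W.density x y / W.outputDensity y) ∂W.ref

/-- `P(y | x)` for an input word `x` and an output word `y`: the channel is memoryless. -/
def likelihood {ι : Type*} [Fintype ι] (x : ι → F) (y : ι → Y) : ℝ≥0 :=
  ∏ i, W.density (x i) (y i)

/-- The law of the output word when the word `x` is transmitted. -/
def law {ι : Type*} [Fintype ι] (x : ι → F) : Measure (ι → Y) :=
  (Measure.pi fun _ => W.ref).withDensity fun y => (W.likelihood x y : ℝ≥0∞)

/-- `d` is a maximum-likelihood decoder for the encoder `enc`. Ties may be broken in any way. -/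
def IsMLDecoder {M ι : Type*} [Fintype ι] (enc : M → ι → F) (d : (ι → Y) → M) : Prop :=
  ∀ y v, W.likelihood (enc v) y ≤ W.likelihood (enc (d y)) y

/-- Maximum-likelihood decoders exist for every channel and every encoder. -/
theorem exists_isMLDecoder {M ι : Type*} [Finite M] [Nonempty M] [Fintype ι]
    (enc : M → ι → F) : ∃ d, W.IsMLDecoder enc d := by
  choose d hd using fun y : ι → Y => Finite.exists_max fun v => W.likelihood (enc v) y
  exact ⟨d, hd⟩

/-- The frame error rate: the probability that the decoded message differs from the transmitted
message, the latter being uniformly distributed on `M`. -/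
def frameErrorRate {M ι : Type*} [Fintype M] [Fintype ι] (enc : M → ι → F)
    (d : (ι → Y) → M) : ℝ≥0∞ :=
  (∑ v, W.law (enc v) {y | d y ≠ v}) / (Fintype.card M : ℝ≥0∞)

end MemorylessChannel

/-- `f` is a primitive polynomial over the finite field `F`: it is monic and irreducible, and its
root in `F[x]/(f)`, the field with `q = |F| ^ deg f` elements, has multiplicative order `q - 1`. -/
structure IsPrimitivePoly {F : Type*} [Field F] [Fintype F] (f : F[X]) : Prop where
  monic : f.Monic
  irreducible : Irreducible f
  orderOf_root : orderOf (AdjoinRoot.root f) = Fintype.card F ^ f.natDegree - 1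

/-- Primitive polynomials of every positive degree exist over every finite field. -/
theorem exists_isPrimitivePoly (F : Type*) [Field F] [Fintype F] (m : ℕ) (hm : 0 < m) :
    ∃ f : F[X], IsPrimitivePoly f ∧ f.natDegree = m := by
  obtain ⟨p, _⟩ := CharP.exists F
  have : Fact p.Prime := ⟨CharP.char_is_prime F p⟩
  have : NeZero m := ⟨hm.ne'⟩
  let _ : Algebra (ZMod p) F := ZMod.algebra F p
  let E := FiniteField.Extension F p m
  have : Finite E := Module.finite_of_finite F
  obtain ⟨g, hg⟩ := IsCyclic.exists_generator (α := Eˣ)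
  have hint : IsIntegral F (g : E) := Algebra.IsIntegral.isIntegral _
  have htop : IntermediateField.adjoin F {(g : E)} = ⊤ := by
    rw [eq_top_iff]
    intro x _
    by_cases hx : x = 0
    · rw [hx]; exact zero_mem _
    · obtain ⟨i, hi⟩ := hg (Units.mk0 x hx)
      have hi' : (g : E) ^ i = x := by
        have := congrArg (Units.val) hi
        simpa using this
      rw [← hi']
      exact zpow_mem (IntermediateField.mem_adjoin_simple_self F _) i
  have hdeg : (minpoly F (g : E)).natDegree = m := by
    rw [← IntermediateField.adjoin.finrank hint, htop, IntermediateField.finrank_top',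
      FiniteField.finrank_extension]
  refine ⟨minpoly F (g : E), ⟨minpoly.monic hint, minpoly.irreducible hint, ?_⟩, hdeg⟩
  have : Fact (Irreducible (minpoly F (g : E))) := ⟨minpoly.irreducible hint⟩
  let ψ : AdjoinRoot (minpoly F (g : E)) →ₐ[F] E :=
    (IntermediateField.val _).comp (IntermediateField.adjoinRootEquivAdjoin F hint).toAlgHom
  have hψ : ψ (AdjoinRoot.root _) = g := by
    simp [ψ, IntermediateField.adjoinRootEquivAdjoin_apply_root]
  rw [hdeg, ← orderOf_injective (ψ : AdjoinRoot (minpoly F (g : E)) →* E)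
    ψ.toRingHom.injective]
  rw [show (ψ : AdjoinRoot (minpoly F (g : E)) →* E) (AdjoinRoot.root _) = g from hψ,
    orderOf_units, orderOf_eq_card_of_forall_mem_zpowers hg, Nat.card_units,
    FiniteField.natCard_extension, Nat.card_eq_fintype_card]

section Codes

variable {F : Type*} [Field F] {f : F[X]}

/-- The correspondence `φ(b) = ∑ j, b j * α ^ j` between `F ^ m` and `F[x]/(f)`, where
`m = deg f` and `α` is the root of `f`. -/
def phi (hf : f.Monic) : (Fin f.natDegree → F) ≃ₗ[F] AdjoinRoot f :=
  (AdjoinRoot.powerBasisAux' hf).equivFun.symm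

theorem phi_apply (hf : f.Monic) (b : Fin f.natDegree → F) :
    phi hf b = ∑ j, b j • AdjoinRoot.root f ^ (j : ℕ) := by
  rw [phi, Module.Basis.equivFun_symm_apply]
  refine Finset.sum_congr rfl fun j _ => ?_
  congr 1
  exact (AdjoinRoot.powerBasis' hf).basis_eq_pow j

/-- The `k × n` generator matrix with entries `α ^ (s t) * α ^ (i * t)`: the Reed-Solomon generator
matrix with evaluation points `α ^ t`, whose column `t` is scaled by `α ^ (s t)`. -/
def generatorMatrix (f : F[X]) (k n : ℕ) (s : Fin n → ℕ) :
    Matrix (Fin k) (Fin n) (AdjoinRoot f) :=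
  Matrix.of fun i t => AdjoinRoot.root f ^ s t * AdjoinRoot.root f ^ ((i : ℕ) * (t : ℕ))

/-- The encoder of the image over `F` of the generalized Reed-Solomon coset code with scaling
exponents `s` and shift `a`: a message `v` of `K = k * m` symbols of `F` becomes the word
`φ⁻¹(φ(v) G + a)` of `N = n * m` symbols of `F`, where `φ` is applied componentwise. -/
def encode (hf : f.Monic) (k n : ℕ) (s : Fin n → ℕ) (a : Fin n → AdjoinRoot f)
    (v : Fin k × Fin f.natDegree → F) : Fin n × Fin f.natDegree → F :=
  fun i => (phi hf).symm
    (Matrix.vecMul (fun r => phi hf fun j => v (r, j)) (generatorMatrix f k n s) i.1 + a i.1) i.2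

end Codes

end GRS

end

/-! Fix a rational `r = k / n` with `R < r < I(X;Y)`. Then `n` and `k` stay constant, and only the
extension degree `m` grows, so that `N = n * m`. Draw the column multipliers and the shift uniformly
at random.

The shift makes each transmitted word uniform. The multipliers make differences of codewords almost
uniform, by the MDS property: a word with `w < k` zeros is a scaled codeword for at most `q^(k-w) *
(q-1)^w` pairs of multipliers and nonzero messages, and a word with `k` or more zeros for none
(`card_scaledCodewords_le`). The loss against uniformity is at most `(q/(q-1))^n ≤ 2^n`, which does
not depend on `m`.

Gallager's argument (`card_confusing_mul_le`, `exists_frameErrorRate_le`) then gives a code with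
`FER ≤ (2^n * q^k)^s * A(s)^N`, where `A(s)` is the mean over `x` of `∫ P(y|x)^(1-s) P(y)^s`. Since
`A(s) ≤ 1 - s I log p + C s^2` with `p = |F|` (`affinity_le`), the bound is at most `2^(ns) * exp(-N
(s (I - r) log p - C s^2))`. For a small fixed `s` this tends to `0` as `m` grows. -/

noncomputable section

namespace GRS

/-! ### Counting scaled Reed–Solomon codewords -/

/-- A nonzero polynomial of degree less than `k` has fewer than `k` roots. -/
theorem eq_zero_of_sum_mul_pow_eq_zero {K ι : Type*} [Field K] {k : ℕ} (x : ι → K)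
    (T : Finset ι) (hx : Set.InjOn x T) (hT : k ≤ T.card) (u : Fin k → K)
    (hu : ∀ t ∈ T, ∑ i, u i * x t ^ (i : ℕ) = 0) : u = 0 := by
  obtain ⟨T', hT', hc⟩ := Finset.exists_subset_card_eq hT
  let e := T'.equivFinOfCardEq hc
  refine Matrix.eq_zero_of_forall_index_sum_mul_pow_eq_zero
    (f := fun j : Fin k => x (e.symm j)) ?_ fun j => hu _ (hT' (e.symm j).2)
  intro i j hij
  exact e.symm.injective (Subtype.ext (hx (hT' (e.symm i).2) (hT' (e.symm j).2) hij))

/-- For a Reed-Solomon code with random column multipliers, the number of pairs of multipliers and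
nonzero messages that yield a given word is at most `2 ^ n` times the number obtained if all words
were equally frequent. -/
theorem card_scaledCodewords_le {K : Type*} [Field K] [Fintype K] {q : ℕ}
    (hq : Fintype.card K = q) (α : K) (hα : orderOf α = q - 1) {k n : ℕ} (hkn : k ≤ n)
    (hn : n ≤ q - 1) (z : Fin n → K) :
    Nat.card {p : (Fin n → Fin (q - 1)) × (Fin k → K) //
      p.2 ≠ 0 ∧ ∀ t, α ^ (p.1 t : ℕ) * ∑ i, p.2 i * (α ^ (t : ℕ)) ^ (i : ℕ) = z t} *
        q ^ n ≤ 2 ^ n * q ^ k * (q - 1) ^ n := by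
  classical
  have hq1 : 1 < q := hq ▸ Fintype.one_lt_card
  have hα0 : α ≠ 0 := by
    rintro rfl
    rw [orderOf_zero] at hα
    omega
  have hinj : Set.InjOn (fun t : Fin n => α ^ (t : ℕ)) Set.univ := by
    intro a _ b _ hab
    have := pow_injOn_Iio_orderOf (x := α) (x₁ := a) (x₂ := b) (by simp; omega) (by simp; omega) hab
    exact Fin.ext this
  set T : Finset (Fin n) := Finset.univ.filter fun t => z t = 0 with hTdef
  have hroot : ∀ (s : Fin n → Fin (q - 1)) (u : Fin k → K),
      (∀ t, α ^ (s t : ℕ) * ∑ i, u i * (α ^ (t : ℕ)) ^ (i : ℕ) = z t) →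
      ∀ t ∈ T, ∑ i, u i * (α ^ (t : ℕ)) ^ (i : ℕ) = 0 := by
    intro s u h t ht
    have h1 := h t
    rw [(Finset.mem_filter.1 ht).2] at h1
    exact (mul_eq_zero.1 h1).resolve_left (pow_ne_zero _ hα0)
  -- A nonzero message polynomial of degree below `k` cannot vanish at `k` evaluation points.
  rcases le_or_gt k T.card with hTk | hTk
  · have : IsEmpty {p : (Fin n → Fin (q - 1)) × (Fin k → K) //
      p.2 ≠ 0 ∧ ∀ t, α ^ (p.1 t : ℕ) * ∑ i, p.2 i * (α ^ (t : ℕ)) ^ (i : ℕ) = z t} :=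
      ⟨fun ⟨p, hp, h⟩ => hp (eq_zero_of_sum_mul_pow_eq_zero _ T (hinj.mono (Set.subset_univ _))
        hTk _ (hroot _ _ h))⟩
    simp
  -- `T'` is an information set containing the zeros of `z`: the message is known from its values on
  -- `T' \ T`, as it vanishes on `T`.
  obtain ⟨T', hTT', -, hT'⟩ := Finset.exists_subsuperset_card_eq (Finset.subset_univ T) hTk.le
    (by simpa using hkn)
  have hcard : Nat.card {p : (Fin n → Fin (q - 1)) × (Fin k → K) //
      p.2 ≠ 0 ∧ ∀ t, α ^ (p.1 t : ℕ) * ∑ i, p.2 i * (α ^ (t : ℕ)) ^ (i : ℕ) = z t} ≤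
      q ^ (k - T.card) * (q - 1) ^ T.card := by
    have hc : Nat.card (((T' \ T : Finset (Fin n)) → K) × (T → Fin (q - 1))) =
        q ^ (k - T.card) * (q - 1) ^ T.card := by
      rw [Nat.card_prod, Nat.card_fun, Nat.card_fun, Nat.card_eq_fintype_card (α := T),
        Nat.card_eq_fintype_card (α := (T' \ T : Finset (Fin n))), Fintype.card_coe,
        Fintype.card_coe, Finset.card_sdiff_of_subset hTT', hT']
      simp [hq]
    rw [← hc]
    refine Nat.card_le_card_of_injective (fun p =>
      (fun t => ∑ i, p.1.2 i * (α ^ ((t : Fin n) : ℕ)) ^ (i : ℕ), fun t => p.1.1 t)) ?_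
    rintro ⟨⟨s, u⟩, hu, h⟩ ⟨⟨s', u'⟩, hu', h'⟩ heq
    simp only [Prod.mk.injEq] at heq
    have huu : u = u' := by
      rw [← sub_eq_zero]
      refine eq_zero_of_sum_mul_pow_eq_zero _ T' (hinj.mono (Set.subset_univ _)) hT'.ge _ ?_
      intro t ht
      simp only [Pi.sub_apply, sub_mul, Finset.sum_sub_distrib, sub_eq_zero]
      by_cases htT : t ∈ T
      · rw [hroot _ _ h t htT, hroot _ _ h' t htT]
      · exact congrFun heq.1 ⟨t, Finset.mem_sdiff.2 ⟨ht, htT⟩⟩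
    subst huu
    have hss : s = s' := by
      funext t
      by_cases htT : t ∈ T
      · exact congrFun heq.2 ⟨t, htT⟩
      -- Off `T` the codeword symbol is nonzero, so the message and `z` determine the multiplier;
      -- only multipliers on `T` are free.
      · have hz : z t ≠ 0 := fun h0 => htT (by simp [hTdef, h0])
        have h1 : α ^ (s t : ℕ) * ∑ i, u i * (α ^ (t : ℕ)) ^ (i : ℕ) = z t := h t
        have h2 : α ^ (s' t : ℕ) * ∑ i, u i * (α ^ (t : ℕ)) ^ (i : ℕ) = z t := h' t
        have hne : ∑ i, u i * (α ^ (t : ℕ)) ^ (i : ℕ) ≠ 0 := by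
          intro h0
          rw [h0, mul_zero] at h1
          exact hz h1.symm
        have h3 := mul_right_cancel₀ hne (h1.trans h2.symm)
        exact Fin.ext (pow_injOn_Iio_orderOf (x := α) (by simp [hα]) (by simp [hα]) h3)
    subst hss
    rfl
  have hTn : T.card ≤ n := by simpa using Finset.card_le_univ T
  calc _ ≤ q ^ (k - T.card) * (q - 1) ^ T.card * q ^ n := Nat.mul_le_mul_right _ hcard
    _ = q ^ k * (q - 1) ^ T.card * q ^ (n - T.card) := by
      have h1 : q ^ n = q ^ T.card * q ^ (n - T.card) := by rw [← pow_add]; congr 1; omega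
      have h2 : q ^ k = q ^ (k - T.card) * q ^ T.card := by rw [← pow_add]; congr 1; omega
      rw [h1, h2]; ring
    -- `q ≤ 2 * (q - 1)` because `q ≥ 2`; this is the source of the factor `2 ^ n`.
    _ ≤ q ^ k * (q - 1) ^ T.card * (2 * (q - 1)) ^ (n - T.card) := by
      gcongr; omega
    _ = q ^ k * 2 ^ (n - T.card) * (q - 1) ^ n := by
      have h1 : (q - 1) ^ n = (q - 1) ^ T.card * (q - 1) ^ (n - T.card) := by
        rw [← pow_add]; congr 1; omega
      rw [h1, mul_pow]; ring
    _ ≤ q ^ k * 2 ^ n * (q - 1) ^ n := by gcongr <;> omega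
    _ = _ := by ring

/-! ### Second-order expansion of `t ^ (1 - s)` at `s = 0` -/

/-- For `u ≥ -1`, multiply `(1 - u) * exp u ≤ 1` by `1 + u`. For `u < -1`, `exp u ≤ 1 ≤ 1 + u + u ^
2`. -/
theorem exp_le_one_add_add_sq_mul (u : ℝ) : Real.exp u ≤ 1 + u + u ^ 2 * (1 + Real.exp u) := by
  have h0 := Real.exp_pos u
  rcases le_or_gt (-1) u with h | h
  · have h1 : (1 - u) * Real.exp u ≤ 1 := by
      have h2 := Real.add_one_le_exp (-u)
      have h3 : Real.exp (-u) * Real.exp u = 1 := by rw [← Real.exp_add]; simp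
      nlinarith
    nlinarith [mul_le_mul_of_nonneg_left h1 (by linarith : 0 ≤ 1 + u), sq_nonneg u]
  · have h1 : Real.exp u ≤ 1 := Real.exp_le_one_iff.2 (by linarith)
    nlinarith [mul_nonneg (sq_nonneg u) h0.le]

/-- Apply the previous bound at `u = -s * log t`; the point is a remainder uniform in `t`. For `t ≤
1`, both `t` and `t ^ (1 - s)` are at most `t ^ (1/2)`, and `(log t * t ^ (1/4)) ^ 2 ≤ 16`, whence
`32`. For `t ≥ 1` both are at most `p`. -/
theorem rpow_one_sub_le {t p s : ℝ} (ht : 0 < t) (htp : t ≤ p) (hp : 1 ≤ p) (hs0 : 0 ≤ s)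
    (hs : s ≤ 1 / 2) :
    t ^ (1 - s) ≤ t - s * (t * Real.log t) + s ^ 2 * (32 + 2 * p * Real.log p ^ 2) := by
  have hexp : t ^ (1 - s) = t * Real.exp (-(s * Real.log t)) := by
    rw [Real.rpow_def_of_pos ht, ← Real.exp_log ht, ← Real.exp_add, Real.log_exp]
    ring_nf
  have h1 := mul_le_mul_of_nonneg_left (exp_le_one_add_add_sq_mul (-(s * Real.log t))) ht.le
  rw [mul_add t _ (_ * _)] at h1
  have h2 : Real.log t ^ 2 * (t + t ^ (1 - s)) ≤ 32 + 2 * p * Real.log p ^ 2 := by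
    have hlp : 0 ≤ Real.log p := Real.log_nonneg hp
    rcases le_total t 1 with h | h
    · have h3 := (Real.abs_log_mul_self_rpow_lt t (1 / 4) ht h (by norm_num)).le
      have h4 : (Real.log t * t ^ (1 / 4 : ℝ)) ^ 2 ≤ 16 := by
        rw [← sq_abs]
        have := abs_nonneg (Real.log t * t ^ (1 / 4 : ℝ))
        nlinarith
      have h5 : (t ^ (1 / 4 : ℝ)) ^ 2 = t ^ (1 / 2 : ℝ) := by
        rw [← Real.rpow_natCast, ← Real.rpow_mul ht.le]; norm_num
      rw [mul_pow, h5] at h4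
      have h6 : t ≤ t ^ (1 / 2 : ℝ) := by
        simpa using Real.rpow_le_rpow_of_exponent_ge ht h (by norm_num : (1 / 2 : ℝ) ≤ 1)
      have h7 : t ^ (1 - s) ≤ t ^ (1 / 2 : ℝ) :=
        Real.rpow_le_rpow_of_exponent_ge ht h (by linarith)
      have h8 : 0 ≤ 2 * p * Real.log p ^ 2 := by positivity
      nlinarith [sq_nonneg (Real.log t)]
    · have h3 : t ^ (1 - s) ≤ t := by
        simpa using Real.rpow_le_rpow_of_exponent_le h (by linarith : 1 - s ≤ 1)
      have h4 : Real.log t ≤ Real.log p := Real.log_le_log ht htp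
      have h5 : 0 ≤ Real.log t := Real.log_nonneg h
      have h6 : Real.log t ^ 2 ≤ Real.log p ^ 2 := by gcongr
      have h7 : t + t ^ (1 - s) ≤ 2 * p := by linarith
      have : 0 ≤ t + t ^ (1 - s) := by positivity
      nlinarith [mul_le_mul h6 h7 this (sq_nonneg _)]
  have h3 := mul_le_mul_of_nonneg_left h2 (sq_nonneg s)
  rw [hexp] at h3 ⊢
  nlinarith

/-! ### Single-letter analysis: mutual information and affinity -/

namespace MemorylessChannel

variable {F Y : Type*} [MeasurableSpace Y] (W : MemorylessChannel F Y)

/-- The density of the channel output under uniform input, with values in `ℝ≥0`. -/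
def outputDensityNN [Fintype F] (y : Y) : ℝ≥0 := (∑ x, W.density x y) / Fintype.card F

/-- The mean of `∫ P(y | x) ^ (1 - s) * P(y) ^ s` over uniform `x`. -/
def affinity [Fintype F] (s : ℝ) : ℝ≥0∞ :=
  (Fintype.card F : ℝ≥0∞)⁻¹ *
    ∑ x, ∫⁻ y, ((W.density x y ^ (1 - s) * W.outputDensityNN y ^ s : ℝ≥0) : ℝ≥0∞) ∂W.ref

theorem integrable_density (x : F) : Integrable (fun y => (W.density x y : ℝ)) W.ref := by
  refine ⟨(W.measurable_density x).coe_nnreal_real.aestronglyMeasurable, ?_⟩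
  simp [HasFiniteIntegral, W.lintegral_density x]

theorem integral_density (x : F) : ∫ y, (W.density x y : ℝ) ∂W.ref = 1 := by
  rw [integral_eq_lintegral_of_nonneg_ae (Filter.Eventually.of_forall fun _ => NNReal.coe_nonneg _)
    (W.measurable_density x).coe_nnreal_real.aestronglyMeasurable]
  simp [W.lintegral_density x]

variable [Fintype F]

theorem coe_outputDensityNN (y : Y) : (W.outputDensityNN y : ℝ) = W.outputDensity y := by
  simp [outputDensityNN, outputDensity]

theorem outputDensity_nonneg (y : Y) : 0 ≤ W.outputDensity y := by
  rw [← coe_outputDensityNN]; exact NNReal.coe_nonneg _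

theorem measurable_outputDensityNN : Measurable W.outputDensityNN := by
  unfold outputDensityNN
  have := W.measurable_density
  fun_prop

theorem measurable_outputDensity : Measurable W.outputDensity := by
  have : W.outputDensity = fun y => (W.outputDensityNN y : ℝ) :=
    funext fun y => (W.coe_outputDensityNN y).symm
  rw [this]
  exact W.measurable_outputDensityNN.coe_nnreal_real

theorem density_le [Nonempty F] (x : F) (y : Y) :
    (W.density x y : ℝ) ≤ Fintype.card F * W.outputDensity y := by
  have hp : (0 : ℝ) < Fintype.card F := by exact_mod_cast Fintype.card_pos
  rw [outputDensity, mul_div_cancel₀ _ hp.ne']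
  exact Finset.single_le_sum (f := fun x => (W.density x y : ℝ)) (fun _ _ => NNReal.coe_nonneg _)
    (Finset.mem_univ x)

theorem integrable_outputDensity : Integrable W.outputDensity W.ref :=
  (integrable_finsetSum _ fun x _ => W.integrable_density x).div_const _

theorem integral_outputDensity [Nonempty F] : ∫ y, W.outputDensity y ∂W.ref = 1 := by
  have hp : (Fintype.card F : ℝ) ≠ 0 := by exact_mod_cast Fintype.card_ne_zero
  unfold outputDensity
  rw [integral_div, integral_finsetSum _ fun x _ => W.integrable_density x]
  simp [integral_density, hp]

theorem density_mul_log_le [Nonempty F] (x : F) (y : Y) :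
    (W.density x y : ℝ) * Real.log (W.density x y / W.outputDensity y) ≤
      W.density x y * Real.log (Fintype.card F) := by
  rcases (NNReal.coe_nonneg (W.density x y)).eq_or_lt with h | h
  · simp [← h]
  · have h1 := W.density_le x y
    have hp : (0 : ℝ) < Fintype.card F := by exact_mod_cast Fintype.card_pos
    have hQ : 0 < W.outputDensity y := by
      by_contra hn
      nlinarith
    gcongr
    rw [div_le_iff₀ hQ]
    exact h1

theorem density_mul_log_ge [Nonempty F] (x : F) (y : Y) :
    -W.outputDensity y ≤
      (W.density x y : ℝ) * Real.log (W.density x y / W.outputDensity y) := by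
  rcases (NNReal.coe_nonneg (W.density x y)).eq_or_lt with h | h
  · simp [← h, W.outputDensity_nonneg y]
  · have h1 := W.density_le x y
    have hp : (0 : ℝ) < Fintype.card F := by exact_mod_cast Fintype.card_pos
    have hQ : 0 < W.outputDensity y := by
      by_contra hn
      nlinarith
    have h2 := Real.one_sub_inv_le_log_of_pos (div_pos h hQ)
    have h3 := mul_le_mul_of_nonneg_left h2 h.le
    have h4 : (W.density x y : ℝ) * (1 - (W.density x y / W.outputDensity y)⁻¹) =
        W.density x y - W.outputDensity y := by
      field_simp
    linarith

/-- No moment condition is needed: with finite input alphabet, the density ratio is at most `|F|`,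
and `log x ≥ 1 - 1/x` bounds the integrand below by minus the output density. -/
theorem integrable_density_mul_log [Nonempty F] (x : F) :
    Integrable (fun y => (W.density x y : ℝ) *
      Real.log (W.density x y / W.outputDensity y)) W.ref := by
  refine Integrable.mono' (g := fun y => W.outputDensity y +
    W.density x y * Real.log (Fintype.card F))
    (W.integrable_outputDensity.add ((W.integrable_density x).mul_const _)) ?_ ?_
  · have h1 := (W.measurable_density x).coe_nnreal_real
    have h2 := W.measurable_outputDensity
    exact (h1.mul (Real.measurable_log.comp (h1.div h2))).aestronglyMeasurable
  · refine Filter.Eventually.of_forall fun y => ?_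
    have hl : 0 ≤ Real.log (Fintype.card F) := Real.log_natCast_nonneg _
    have := mul_nonneg (NNReal.coe_nonneg (W.density x y)) hl
    rw [Real.norm_eq_abs, abs_le]
    constructor
    · linarith [W.density_mul_log_ge x y]
    · linarith [W.density_mul_log_le x y, W.outputDensity_nonneg y]

theorem mutualInfo_mul_log [Nontrivial F] :
    W.mutualInfo * Real.log (Fintype.card F) =
      (Fintype.card F : ℝ)⁻¹ * ∑ x, ∫ y, (W.density x y : ℝ) *
        Real.log (W.density x y / W.outputDensity y) ∂W.ref := by
  have hl : Real.log (Fintype.card F) ≠ 0 :=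
    (Real.log_pos (by exact_mod_cast Fintype.one_lt_card)).ne'
  rw [mutualInfo, Finset.sum_mul, Finset.mul_sum]
  refine Finset.sum_congr rfl fun x _ => ?_
  simp only [Real.logb, mul_div_assoc', integral_div]
  field_simp

theorem mutualInfo_le_one [Nontrivial F] : W.mutualInfo ≤ 1 := by
  have hl : 0 < Real.log (Fintype.card F) :=
    Real.log_pos (by exact_mod_cast Fintype.one_lt_card)
  have hp : (0 : ℝ) < Fintype.card F := by exact_mod_cast Fintype.card_pos
  refine le_of_mul_le_mul_right ?_ hl
  rw [mutualInfo_mul_log, one_mul, inv_mul_le_iff₀ hp, ← nsmul_eq_mul]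
  refine Finset.sum_le_card_nsmul _ _ _ fun x _ => ?_
  refine (integral_mono (W.integrable_density_mul_log x) ((W.integrable_density x).mul_const _)
    (W.density_mul_log_le x)).trans ?_
  rw [integral_mul_const, integral_density, one_mul]

/-- This is `rpow_one_sub_le` at the ratio `t = w / Q` of density to output density, multiplied by
`Q`. The remainder thus carries a factor `Q`, which integrates to `1` even if the reference measure
is infinite. -/
theorem density_rpow_mul_le [Nontrivial F] {s : ℝ} (hs0 : 0 ≤ s) (hs : s ≤ 1 / 2) (x : F) (y : Y) :
    (W.density x y : ℝ) ^ (1 - s) * W.outputDensity y ^ s ≤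
      W.density x y - s * (W.density x y * Real.log (W.density x y / W.outputDensity y)) +
        s ^ 2 * (32 + 2 * Fintype.card F * Real.log (Fintype.card F) ^ 2) *
          W.outputDensity y := by
  have hp : (1 : ℝ) ≤ Fintype.card F := by exact_mod_cast Fintype.card_pos
  rcases (NNReal.coe_nonneg (W.density x y)).eq_or_lt with h | h
  · rw [← h, Real.zero_rpow (by linarith)]
    have := W.outputDensity_nonneg y
    simp only [zero_mul, mul_zero, sub_zero, zero_add]
    positivity
  · have h1 := W.density_le x y
    have hQ : 0 < W.outputDensity y := by
      by_contra hn
      nlinarith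
    set w : ℝ := ((W.density x y : ℝ≥0) : ℝ)
    set Q := W.outputDensity y
    have h2 := mul_le_mul_of_nonneg_left (rpow_one_sub_le (div_pos h hQ)
      ((div_le_iff₀ hQ).2 h1) hp hs0 hs) hQ.le
    have h3 : Q * (w / Q) ^ (1 - s) = w ^ (1 - s) * Q ^ s := by
      rw [Real.div_rpow h.le hQ.le, Real.rpow_sub hQ, Real.rpow_one]
      field_simp
    rw [h3] at h2
    refine h2.trans_eq ?_
    field_simp

theorem affinity_le [Nontrivial F] {s : ℝ} (hs0 : 0 ≤ s) (hs : s ≤ 1 / 2) :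
    W.affinity s ≤ ENNReal.ofReal (1 - s * (W.mutualInfo * Real.log (Fintype.card F)) +
      s ^ 2 * (32 + 2 * Fintype.card F * Real.log (Fintype.card F) ^ 2)) := by
  set C : ℝ := 32 + 2 * Fintype.card F * Real.log (Fintype.card F) ^ 2
  have hp : (0 : ℝ) < Fintype.card F := by exact_mod_cast Fintype.card_pos
  set h : F → Y → ℝ := fun x y =>
    W.density x y - s * (W.density x y * Real.log (W.density x y / W.outputDensity y)) +
      s ^ 2 * C * W.outputDensity y with hh
  have hint (x : F) : Integrable (h x) W.ref :=
    ((W.integrable_density x).sub ((W.integrable_density_mul_log x).const_mul s)).add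
      (W.integrable_outputDensity.const_mul _)
  have hle (x : F) (y : Y) := W.density_rpow_mul_le hs0 hs x y
  have hnn (x : F) (y : Y) : 0 ≤ h x y := le_trans (mul_nonneg
    (Real.rpow_nonneg (NNReal.coe_nonneg _) _) (Real.rpow_nonneg (W.outputDensity_nonneg y) _))
    (hle x y)
  have hI (x : F) : ∫ y, h x y ∂W.ref = 1 - s * (∫ y, (W.density x y : ℝ) *
      Real.log (W.density x y / W.outputDensity y) ∂W.ref) + s ^ 2 * C := by
    have h1 : Integrable (fun y => (W.density x y : ℝ) - s * (W.density x y *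
        Real.log (W.density x y / W.outputDensity y))) W.ref :=
      (W.integrable_density x).sub ((W.integrable_density_mul_log x).const_mul s)
    simp only [hh]
    rw [integral_add h1 (W.integrable_outputDensity.const_mul _),
      integral_sub (W.integrable_density x) ((W.integrable_density_mul_log x).const_mul s),
      integral_const_mul, integral_const_mul, integral_density, integral_outputDensity, mul_one]
  have hx (x : F) : ∫⁻ y, ((W.density x y ^ (1 - s) * W.outputDensityNN y ^ s : ℝ≥0) : ℝ≥0∞)
      ∂W.ref ≤ ENNReal.ofReal (∫ y, h x y ∂W.ref) := by
    rw [ofReal_integral_eq_lintegral_ofReal (hint x) (Filter.Eventually.of_forall (hnn x))]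
    refine lintegral_mono fun y => ?_
    rw [← ENNReal.ofReal_coe_nnreal]
    refine ENNReal.ofReal_le_ofReal ?_
    simpa [coe_outputDensityNN] using hle x y
  have hsum : (Fintype.card F : ℝ)⁻¹ * ∑ x, ∫ y, h x y ∂W.ref =
      1 - s * (W.mutualInfo * Real.log (Fintype.card F)) + s ^ 2 * C := by
    rw [mutualInfo_mul_log]
    simp only [hI, Finset.sum_add_distrib, Finset.sum_sub_distrib, ← Finset.mul_sum,
      Finset.sum_const, Finset.card_univ, nsmul_eq_mul]
    field_simp
  rw [← hsum, ENNReal.ofReal_mul (by positivity), ENNReal.ofReal_inv_of_pos hp,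
    ENNReal.ofReal_natCast, ENNReal.ofReal_sum_of_nonneg fun x _ => integral_nonneg (hnn x)]
  exact mul_le_mul_right (Finset.sum_le_sum fun x _ => hx x) _

end MemorylessChannel
-- Random coding bound for coset ensembles
theorem lintegral_prod_pi {ι Y : Type*} [Fintype ι] [MeasurableSpace Y] (μ : Measure Y)
    [SigmaFinite μ] (f : ι → Y → ℝ≥0) (hf : ∀ i, Measurable (f i))
    (hfin : ∀ i, ∫⁻ y, (f i y : ℝ≥0∞) ∂μ ≠ ⊤) :
    ∫⁻ y : ι → Y, ((∏ i, f i (y i) : ℝ≥0) : ℝ≥0∞) ∂Measure.pi (fun _ => μ) =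
      ∏ i, ∫⁻ y, (f i y : ℝ≥0∞) ∂μ := by
  have hint (i : ι) : Integrable (fun y => (f i y : ℝ)) μ := by
    refine ⟨(hf i).coe_nnreal_real.aestronglyMeasurable, ?_⟩
    simpa [HasFiniteIntegral] using (hfin i).lt_top
  have hint' : Integrable (fun y : ι → Y => ∏ i, (f i (y i) : ℝ)) (Measure.pi fun _ => μ) :=
    Integrable.fintype_prod (f := fun i y => (f i y : ℝ)) hint
  have h1 := ofReal_integral_eq_lintegral_ofReal hint' (Filter.Eventually.of_forall fun y =>
    Finset.prod_nonneg fun i _ => NNReal.coe_nonneg _)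
  rw [integral_fintype_prod_eq_prod (fun i y => (f i y : ℝ)), ENNReal.ofReal_prod_of_nonneg
    fun i _ => integral_nonneg fun _ => NNReal.coe_nonneg _] at h1
  have h2 (i : ι) : ENNReal.ofReal (∫ y, (f i y : ℝ) ∂μ) = ∫⁻ y, (f i y : ℝ≥0∞) ∂μ := by
    rw [ofReal_integral_eq_lintegral_ofReal (hint i)
      (Filter.Eventually.of_forall fun _ => NNReal.coe_nonneg _)]
    simp
  simp only [h2] at h1
  rw [h1]
  refine lintegral_congr fun y => ?_
  rw [← ENNReal.ofReal_coe_nnreal]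
  simp

/-- If, in a finite ensemble of codes, the differences of codewords are distributed almost
uniformly, then the number of codes of the ensemble for which some codeword is at least as likely
as the transmitted word `x` is bounded by a power of the ratio of the mean likelihood to that of
`x`. -/
theorem card_confusing_mul_le {X B M : Type*} [AddCommGroup X] [Fintype X] [Fintype B] [Fintype M]
    (g : B → M → X) (D : ℝ≥0) (v : M)
    (hD : ∀ z, (Nat.card {p : B × M // p.2 ≠ v ∧ g p.1 p.2 - g p.1 v = z} : ℝ≥0) *
      Fintype.card X ≤ D * Fintype.card B)
    (L : X → ℝ≥0) (x : X) {s : ℝ} (hs0 : 0 ≤ s) (hs1 : s ≤ 1) :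
    (Nat.card {b : B // ∃ v' ≠ v, L x ≤ L (x + (g b v' - g b v))} : ℝ≥0) * L x ≤
      Fintype.card B * D ^ s * (L x ^ (1 - s) * ((∑ x', L x') / Fintype.card X) ^ s) := by
  classical
  set c := Nat.card {b : B // ∃ v' ≠ v, L x ≤ L (x + (g b v' - g b v))} with hc
  have hX : (0 : ℝ≥0) < Fintype.card X := by exact_mod_cast Fintype.card_pos
  have hcB : (c : ℝ≥0) ≤ Fintype.card B := by
    rw [← Nat.card_eq_fintype_card (α := B)]
    exact_mod_cast Finite.card_subtype_le _
  -- Union bound over the competitors, grouped by the word `x'` that competes with `x`.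
  have h1 : c ≤ ∑ x' : X, if L x ≤ L x' then
      Nat.card {p : B × M // p.2 ≠ v ∧ g p.1 p.2 - g p.1 v = x' - x} else 0 := by
    have : c ≤ Nat.card {p : B × M // p.2 ≠ v ∧ L x ≤ L (x + (g p.1 p.2 - g p.1 v))} := by
      refine Nat.card_le_card_of_surjective
        (fun p => ⟨p.1.1, p.1.2, p.2.1, p.2.2⟩) ?_
      rintro ⟨b, v', hv', h⟩
      exact ⟨⟨(b, v'), hv', h⟩, rfl⟩
    refine this.trans ?_
    simp only [Nat.card_eq_fintype_card, Fintype.card_subtype]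
    rw [Finset.card_eq_sum_card_fiberwise (f := fun p : B × M => x + (g p.1 p.2 - g p.1 v))
      (t := Finset.univ) (fun _ _ => by simp)]
    refine Finset.sum_le_sum fun x' _ => ?_
    split_ifs with h
    · refine Finset.card_le_card fun p hp => ?_
      simp only [Finset.mem_filter, Finset.mem_univ, true_and] at hp ⊢
      refine ⟨hp.1.1, ?_⟩
      rw [← hp.2]; abel
    · rw [Nat.le_zero, Finset.card_eq_zero, Finset.filter_eq_empty_iff]
      intro p hp hpx
      simp only [Finset.mem_filter, Finset.mem_univ, true_and] at hp
      exact h (hpx ▸ hp.2)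
  have h2 : (c : ℝ≥0) * L x * Fintype.card X ≤ D * Fintype.card B * ∑ x', L x' := by
    calc (c : ℝ≥0) * L x * Fintype.card X
        ≤ ((∑ x' : X, if L x ≤ L x' then
          Nat.card {p : B × M // p.2 ≠ v ∧ g p.1 p.2 - g p.1 v = x' - x} else 0 : ℕ) : ℝ≥0) *
            L x * Fintype.card X := by gcongr
      _ = ∑ x' : X, ((if L x ≤ L x' then
          Nat.card {p : B × M // p.2 ≠ v ∧ g p.1 p.2 - g p.1 v = x' - x} else 0 : ℕ) : ℝ≥0) *
            L x * Fintype.card X := by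
        rw [Nat.cast_sum, Finset.sum_mul, Finset.sum_mul]
      _ ≤ ∑ x' : X, D * Fintype.card B * L x' := by
        refine Finset.sum_le_sum fun x' _ => ?_
        split_ifs with h
        · rw [mul_right_comm]
          exact mul_le_mul' (hD _) h
        · simp
      _ = _ := by rw [Finset.mul_sum]
  have h3 : (c : ℝ≥0) * L x ≤ Fintype.card B * D * ((∑ x', L x') / Fintype.card X) := by
    rw [mul_div_assoc', le_div_iff₀ hX, mul_comm (_ : ℝ≥0) D]
    exact h2
  -- Interpolate geometrically, with weights `1 - s` and `s`, between the trivial bound `c ≤ |B|`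
  -- and the union bound `h3`.
  calc (c : ℝ≥0) * L x = ((c : ℝ≥0) * L x) ^ (1 - s) * ((c : ℝ≥0) * L x) ^ s := by
        rw [← NNReal.rpow_add_of_nonneg _ (by linarith) hs0]; simp
    _ ≤ (Fintype.card B * L x) ^ (1 - s) *
        (Fintype.card B * D * ((∑ x', L x') / Fintype.card X)) ^ s := by
      gcongr
    _ = ((Fintype.card B : ℝ≥0) ^ (1 - s) * (Fintype.card B : ℝ≥0) ^ s) * D ^ s *
        (L x ^ (1 - s) * ((∑ x', L x') / Fintype.card X) ^ s) := by
      simp only [NNReal.mul_rpow]; ring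
    _ = _ := by
      rw [← NNReal.rpow_add_of_nonneg _ (by linarith) hs0]; simp

namespace MemorylessChannel

variable {F Y : Type*} [MeasurableSpace Y] (W : MemorylessChannel F Y)

theorem measurable_likelihood {ι : Type*} [Fintype ι] (x : ι → F) :
    Measurable (W.likelihood x) :=
  Finset.measurable_fun_prod _ fun i _ => (W.measurable_density (x i)).comp (measurable_pi_apply i)

theorem sum_likelihood_div [Fintype F] {ι : Type*} [Fintype ι] [DecidableEq ι] (y : ι → Y) :
    (∑ x : ι → F, W.likelihood x y) / (Fintype.card (ι → F) : ℝ≥0) =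
      ∏ i, W.outputDensityNN (y i) := by
  simp only [likelihood, outputDensityNN, Finset.prod_div_distrib, Fintype.prod_sum]
  simp

theorem sum_lintegral_likelihood [Fintype F] [Nonempty F] {ι : Type*} [Fintype ι] [DecidableEq ι]
    {s : ℝ} (hfin : W.affinity s ≠ ⊤) :
    ∑ x : ι → F, ∫⁻ y, ((W.likelihood x y ^ (1 - s) *
      (∏ i, W.outputDensityNN (y i)) ^ s : ℝ≥0) : ℝ≥0∞) ∂Measure.pi (fun _ => W.ref) =
      Fintype.card (ι → F) * W.affinity s ^ Fintype.card ι := by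
  have := W.sigmaFinite_ref
  have hp0 : (Fintype.card F : ℝ≥0∞) ≠ 0 := by exact_mod_cast Fintype.card_ne_zero
  have hsum : ∑ x, ∫⁻ y, ((W.density x y ^ (1 - s) * W.outputDensityNN y ^ s : ℝ≥0) : ℝ≥0∞)
      ∂W.ref = Fintype.card F * W.affinity s := by
    rw [affinity, ← mul_assoc, ENNReal.mul_inv_cancel hp0 (ENNReal.natCast_ne_top _), one_mul]
  have hx (x : F) : ∫⁻ y, ((W.density x y ^ (1 - s) * W.outputDensityNN y ^ s : ℝ≥0) : ℝ≥0∞)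
      ∂W.ref ≠ ⊤ := by
    have h : ∑ x, ∫⁻ y, ((W.density x y ^ (1 - s) * W.outputDensityNN y ^ s : ℝ≥0) : ℝ≥0∞)
      ∂W.ref ≠ ⊤ := by
      rw [hsum]; exact ENNReal.mul_ne_top (ENNReal.natCast_ne_top _) hfin
    exact (ENNReal.sum_ne_top.1 h) x (Finset.mem_univ x)
  have hm (x : F) : Measurable fun y => W.density x y ^ (1 - s) * W.outputDensityNN y ^ s :=
    ((W.measurable_density x).pow_const _).mul (W.measurable_outputDensityNN.pow_const _)
  simp only [likelihood, ← NNReal.finsetProd_rpow, ← Finset.prod_mul_distrib]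
  have h (x : ι → F) := lintegral_prod_pi W.ref
    (fun i y => W.density (x i) y ^ (1 - s) * W.outputDensityNN y ^ s) (fun i => hm (x i))
    fun i => hx (x i)
  simp only [h]
  rw [← Fintype.prod_sum (fun (_ : ι) (x : F) => ∫⁻ y,
    ((W.density x y ^ (1 - s) * W.outputDensityNN y ^ s : ℝ≥0) : ℝ≥0∞) ∂W.ref)]
  rw [hsum, Finset.prod_const, Finset.card_univ, mul_pow, Fintype.card_fun, Nat.cast_pow]

/-- The random coding bound for ensembles of coset codes. -/
theorem exists_frameErrorRate_le [AddCommGroup F] [Fintype F] {B M ι : Type*} [Fintype B]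
    [Nonempty B] [Fintype M] [Nonempty M] [Fintype ι] (g : B → M → ι → F) (D : ℝ≥0)
    (hD : ∀ v z, (Nat.card {p : B × M // p.2 ≠ v ∧ g p.1 p.2 - g p.1 v = z} : ℝ≥0) *
      (Fintype.card F : ℝ≥0) ^ Fintype.card ι ≤ D * Fintype.card B)
    {s : ℝ} (hs0 : 0 ≤ s) (hs1 : s ≤ 1) (hfin : W.affinity s ≠ ⊤) :
    ∃ b a, ∀ d, W.IsMLDecoder (fun v => g b v + a) d →
      W.frameErrorRate (fun v => g b v + a) d ≤
        ((D ^ s : ℝ≥0) : ℝ≥0∞) * W.affinity s ^ Fintype.card ι := by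
  classical
  -- The non-strict inequality counts every tie as an error, so the bound holds for any
  -- tie-breaking.
  let E (b : B) (x : ι → F) (v : M) : Set (ι → Y) :=
    {y | ∃ v' ≠ v, W.likelihood x y ≤ W.likelihood (x + (g b v' - g b v)) y}
  have hE (b x v) : MeasurableSet (E b x v) := by
    have : E b x v = ⋃ v', ⋃ (_ : v' ≠ v),
        {y | W.likelihood x y ≤ W.likelihood (x + (g b v' - g b v)) y} := by
      ext y; simp [E]
    rw [this]
    exact MeasurableSet.iUnion fun v' => MeasurableSet.iUnion fun _ =>
      measurableSet_le (W.measurable_likelihood _) (W.measurable_likelihood _)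
  set P : ℝ≥0∞ := ((D ^ s : ℝ≥0) : ℝ≥0∞) * W.affinity s ^ Fintype.card ι with hP
  have hword (v : M) : ∑ b, ∑ x, W.law x (E b x v) ≤
      Fintype.card B * Fintype.card (ι → F) * P := by
    calc ∑ b, ∑ x, W.law x (E b x v)
        = ∑ x : ι → F, ∑ b, ∫⁻ y, (E b x v).indicator
            (fun y => (W.likelihood x y : ℝ≥0∞)) y ∂Measure.pi (fun _ => W.ref) := by
          rw [Finset.sum_comm]
          refine Finset.sum_congr rfl fun x _ => Finset.sum_congr rfl fun b _ => ?_
          rw [law, withDensity_apply _ (hE b x v), lintegral_indicator (hE b x v)]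
      _ = ∑ x : ι → F, ∫⁻ y, ∑ b, (E b x v).indicator
            (fun y => (W.likelihood x y : ℝ≥0∞)) y ∂Measure.pi (fun _ => W.ref) := by
          refine Finset.sum_congr rfl fun x _ => ?_
          rw [lintegral_finsetSum]
          exact fun b _ => ((W.measurable_likelihood x).coe_nnreal_ennreal).indicator (hE b x v)
      _ ≤ ∑ x : ι → F, ∫⁻ y, ((Fintype.card B * D ^ s : ℝ≥0) : ℝ≥0∞) *
            ((W.likelihood x y ^ (1 - s) * (∏ i, W.outputDensityNN (y i)) ^ s : ℝ≥0) : ℝ≥0∞)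
            ∂Measure.pi (fun _ => W.ref) := by
          refine Finset.sum_le_sum fun x _ => lintegral_mono fun y => ?_
          have h := card_confusing_mul_le g D v
            (fun z => by simpa using hD v z) (fun x => W.likelihood x y) x hs0 hs1
          rw [sum_likelihood_div] at h
          rw [← ENNReal.coe_mul]
          refine le_trans (le_of_eq ?_) (ENNReal.coe_le_coe.2 h)
          simp only [Set.indicator_apply, Finset.sum_ite, Finset.sum_const, E, Set.mem_ofPred_eq, nsmul_eq_mul, Nat.card_eq_fintype_card,
            Fintype.card_subtype]
          simp
      _ = Fintype.card B * Fintype.card (ι → F) * P := by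
          simp only [lintegral_const_mul' _ _ ENNReal.coe_ne_top]
          rw [← Finset.mul_sum, sum_lintegral_likelihood W hfin, hP]
          push_cast
          ring
  have htotal : ∑ p : B × (ι → F), ∑ v, W.law (g p.1 v + p.2) (E p.1 (g p.1 v + p.2) v) ≤
      ∑ _p : B × (ι → F), Fintype.card M * P := by
    rw [Finset.sum_comm]
    calc _ ≤ ∑ _v : M, Fintype.card B * Fintype.card (ι → F) * P := by
          refine Finset.sum_le_sum fun v _ => ?_
          rw [Fintype.sum_prod_type]
          refine le_trans (le_of_eq ?_) (hword v)
          refine Finset.sum_congr rfl fun b _ => ?_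
          -- For a fixed code and message, translation by `g b v` permutes the shifts, so the
          -- transmitted word is uniform over all words.
          exact Equiv.sum_comp (Equiv.addLeft (g b v)) fun x => W.law x (E b x v)
      _ = _ := by
          simp only [Finset.sum_const, Finset.card_univ, nsmul_eq_mul, Fintype.card_prod]
          push_cast
          ring
  -- Some code and shift do no worse than the ensemble average.
  obtain ⟨⟨b, a⟩, hba⟩ : ∃ p : B × (ι → F),
      ∑ v, W.law (g p.1 v + p.2) (E p.1 (g p.1 v + p.2) v) ≤ Fintype.card M * P := by
    by_contra! hcon
    exact absurd htotal (not_le.2 (ENNReal.sum_lt_sum_of_nonempty Finset.univ_nonempty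
      fun p _ => hcon p))
  refine ⟨b, a, fun d hd => ?_⟩
  rw [frameErrorRate]
  refine ENNReal.div_le_of_le_mul' (le_trans (Finset.sum_le_sum fun v _ => ?_) hba)
  refine measure_mono fun y hy => ⟨d y, hy, ?_⟩
  have := hd y v
  rwa [show g b v + a + (g b (d y) - g b v) = g b (d y) + a by abel]

end MemorylessChannel
-- The bound for images of generalized Reed–Solomon codes
variable {F : Type*} [Field F] {f : F[X]}

theorem encode_eq_add (hf : f.Monic) (k n : ℕ) (s : Fin n → ℕ)
    (a : Fin n × Fin f.natDegree → F) (v : Fin k × Fin f.natDegree → F) :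
    encode hf k n s (fun t => phi hf fun j => a (t, j)) v = encode hf k n s 0 v + a := by
  funext i
  simp [encode]

/-- The generalized Reed-Solomon codes with given parameters, seen as an ensemble indexed by the
column multipliers, have almost uniformly distributed differences of codewords. -/
theorem card_encode_sub_eq_le [Fintype F] (hf : IsPrimitivePoly f) {k n : ℕ} (hkn : k ≤ n)
    (hn : n ≤ Fintype.card F ^ f.natDegree - 1) (v : Fin k × Fin f.natDegree → F)
    (z : Fin n × Fin f.natDegree → F) :
    Nat.card {p : (Fin n → Fin (Fintype.card F ^ f.natDegree - 1)) ×
        (Fin k × Fin f.natDegree → F) // p.2 ≠ v ∧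
        encode hf.monic k n (fun t => p.1 t) 0 p.2 -
          encode hf.monic k n (fun t => p.1 t) 0 v = z} *
        (Fintype.card F ^ f.natDegree) ^ n ≤
      2 ^ n * (Fintype.card F ^ f.natDegree) ^ k * (Fintype.card F ^ f.natDegree - 1) ^ n := by
  have : Fact (Irreducible f) := ⟨hf.irreducible⟩
  let _ : Fintype (AdjoinRoot f) := Fintype.ofEquiv _ (phi hf.monic).toEquiv
  have hq : Fintype.card (AdjoinRoot f) = Fintype.card F ^ f.natDegree := by
    rw [← Fintype.card_congr (phi hf.monic).toEquiv]
    simp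
  refine (Nat.mul_le_mul_right _ ?_).trans (card_scaledCodewords_le hq (AdjoinRoot.root f)
    hf.orderOf_root hkn hn fun t => phi hf.monic fun j => z (t, j))
  -- By linearity of `φ` and of the unshifted encoder, a difference of codewords is the codeword of
  -- the difference of messages, under the same multipliers.
  refine Nat.card_le_card_of_injective (fun p => ⟨(p.1.1, fun r =>
    phi hf.monic (fun j => p.1.2 (r, j)) - phi hf.monic fun j => v (r, j)), ?_, ?_⟩) ?_
  · intro h0
    refine p.2.1 (funext fun i => ?_)
    have h1 := congrFun h0 i.1
    simp only [Pi.zero_apply, sub_eq_zero] at h1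
    exact congrFun ((phi hf.monic).injective h1) i.2
  · intro t
    have h1 : (fun j => z (t, j)) = fun j => (encode hf.monic k n (fun t => p.1.1 t) 0 p.1.2 -
          encode hf.monic k n (fun t => p.1.1 t) 0 v) (t, j) := by rw [p.2.2]
    rw [h1]
    have h2 : (fun j => (encode hf.monic k n (fun t => p.1.1 t) 0 p.1.2 -
          encode hf.monic k n (fun t => p.1.1 t) 0 v) (t, j)) = (phi hf.monic).symm
        (Matrix.vecMul (fun r => phi hf.monic (fun j => p.1.2 (r, j)) -
          phi hf.monic fun j => v (r, j)) (generatorMatrix f k n fun t => p.1.1 t) t) := by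
      rw [show (fun r => phi hf.monic (fun j => p.1.2 (r, j)) -
          phi hf.monic fun j => v (r, j)) = (fun r => phi hf.monic (fun j => p.1.2 (r, j))) -
          fun r => phi hf.monic fun j => v (r, j) from rfl, Matrix.sub_vecMul]
      funext j
      simp [encode]
    rw [h2, LinearEquiv.apply_symm_apply, Matrix.vecMul, dotProduct, Finset.mul_sum]
    refine Finset.sum_congr rfl fun i _ => ?_
    rw [generatorMatrix, Matrix.of_apply, ← pow_mul, mul_comm (t : ℕ)]
    ring
  · rintro ⟨⟨s, u⟩, hp⟩ ⟨⟨s', u'⟩, hp'⟩ h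
    simp only [Subtype.mk.injEq, Prod.mk.injEq] at h
    obtain ⟨rfl, h⟩ := h
    have : u = u' := funext fun i =>
      congrFun ((phi hf.monic).injective (sub_left_injective (congrFun h i.1))) i.2
    subst this
    rfl

/-- The random coding bound for generalized Reed-Solomon codes. -/
theorem exists_frameErrorRate_encode_le [Fintype F] {Y : Type*} [MeasurableSpace Y]
    (W : MemorylessChannel F Y) (hf : IsPrimitivePoly f) {k n : ℕ} (hkn : k < n)
    (hn : n ≤ Fintype.card F ^ f.natDegree - 1) {s : ℝ} (hs0 : 0 ≤ s) (hs1 : s ≤ 1)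
    (hfin : W.affinity s ≠ ⊤) :
    ∃ (e : Fin n → ℕ) (a : Fin n → AdjoinRoot f),
      (∀ t, e t < Fintype.card F ^ f.natDegree - 1) ∧
      ∀ d, W.IsMLDecoder (encode hf.monic k n e a) d →
        W.frameErrorRate (encode hf.monic k n e a) d ≤
          (((2 ^ n * (Fintype.card F ^ f.natDegree) ^ k : ℝ≥0) ^ s : ℝ≥0) : ℝ≥0∞) *
            W.affinity s ^ (n * f.natDegree) := by
  have : NeZero (Fintype.card F ^ f.natDegree - 1) := ⟨by omega⟩
  obtain ⟨b, a, h⟩ := W.exists_frameErrorRate_le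
    (B := Fin n → Fin (Fintype.card F ^ f.natDegree - 1))
    (fun b v => encode hf.monic k n (fun t => b t) 0 v)
    -- The ensemble has `(q - 1) ^ n` multiplier vectors and there are `q ^ n` words, so the count
    -- gives `D = 2 ^ n * q ^ k`.
    (2 ^ n * (Fintype.card F ^ f.natDegree) ^ k)
    (fun v z => by
      have := card_encode_sub_eq_le hf hkn.le hn v z
      rw [← pow_mul, mul_comm f.natDegree] at this
      rw [Fintype.card_prod, Fintype.card_fun, Fintype.card_fin, Fintype.card_fin,
        Fintype.card_fin]
      exact_mod_cast this) hs0 hs1 hfin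
  refine ⟨fun t => b t, fun t => phi hf.monic fun j => a (t, j), fun t => (b t).2, ?_⟩
  have henc : encode hf.monic k n (fun t => b t) (fun t => phi hf.monic fun j => a (t, j)) =
      fun v => encode hf.monic k n (fun t => b t) 0 v + a :=
    funext fun v => encode_eq_add hf.monic k n _ a v
  rw [henc]
  simpa using h

end GRS

end

/-! ### Choice of parameters and conclusion -/

theorem theorem1 {F : Type*} [Field F] [Fintype F] {Y : Type*} [MeasurableSpace Y]
    (W : GRS.MemorylessChannel F Y) (R : ℝ) (hR : 0 < R) (hRI : R < W.mutualInfo)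
    (ε : ℝ) (hε : 0 < ε) :
    ∃ m₀ : ℕ, ∀ (f : F[X]) (hf : GRS.IsPrimitivePoly f), m₀ ≤ f.natDegree →
      ∃ (n k : ℕ) (s : Fin n → ℕ) (a : Fin n → AdjoinRoot f),
        0 < k ∧ k < n ∧ n ≤ Fintype.card F ^ f.natDegree - 1 ∧
        (∀ t, s t < Fintype.card F ^ f.natDegree - 1) ∧
        R ≤ ((k * f.natDegree : ℕ) : ℝ) / ((n * f.natDegree : ℕ) : ℝ) ∧
        ∀ d : (Fin n × Fin f.natDegree → Y) → (Fin k × Fin f.natDegree → F),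
          W.IsMLDecoder (GRS.encode hf.monic k n s a) d →
          W.frameErrorRate (GRS.encode hf.monic k n s a) d ≤ ENNReal.ofReal ε := by
  obtain ⟨r, hRr, hrI⟩ := exists_rat_btwn hRI
  have hr0 : (0 : ℝ) < r := hR.trans hRr
  have hr1 : (r : ℝ) < 1 := hrI.trans_le W.mutualInfo_le_one
  obtain ⟨k, hk⟩ : ∃ k : ℕ, r.num = k :=
    ⟨r.num.toNat, (Int.toNat_of_nonneg (Rat.num_nonneg.2 (by exact_mod_cast hr0.le))).symm⟩
  set n := r.den with hn
  have hn0 : (0 : ℝ) < n := by exact_mod_cast r.den_pos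
  have hkn : (r : ℝ) = k / n := by
    rw [Rat.cast_def, hk, Int.cast_natCast]
  have hk0 : 0 < k := by
    rw [hkn] at hr0
    exact_mod_cast (div_pos_iff_of_pos_right hn0).1 hr0
  have hkn' : k < n := by
    rw [hkn, div_lt_one hn0] at hr1
    exact_mod_cast hr1
  set p : ℝ := ((Fintype.card F : ℕ) : ℝ) with hp
  have hp1 : 1 < p := Nat.one_lt_cast.2 Fintype.one_lt_card
  have hl : 0 < Real.log p := Real.log_pos hp1
  set C : ℝ := 32 + 2 * p * Real.log p ^ 2 with hC
  have hC0 : 0 < C := by positivity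
  set δ : ℝ := (W.mutualInfo - r) * Real.log p with hδ
  have hδ0 : 0 < δ := mul_pos (by linarith) hl
  -- The cap `1 / 2` is required by `affinity_le`; the other term lets the quadratic error consume
  -- at most half of the gain `s * δ`.
  set s : ℝ := min (1 / 2) (δ / (2 * C)) with hs
  have hs0 : 0 < s := lt_min (by norm_num) (by positivity)
  have hs1 : s ≤ 1 / 2 := min_le_left _ _
  have hsC : s ^ 2 * C ≤ s * δ / 2 := by
    have h1 : s ≤ δ / (2 * C) := min_le_right _ _
    rw [le_div_iff₀ (by positivity)] at h1
    nlinarith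
  have haff : W.affinity s ≤
      ENNReal.ofReal (Real.exp (-(s * (W.mutualInfo * Real.log p)) + s * δ / 2)) := by
    refine (W.affinity_le hs0.le hs1).trans (ENNReal.ofReal_le_ofReal ?_)
    refine le_trans ?_ (Real.add_one_le_exp _)
    linarith
  -- From `m₁` on, `s * n * log 2 - m * n * s * δ / 2 ≤ log ε`, which is the final estimate.
  obtain ⟨m₁, hm₁⟩ := exists_nat_ge
    ((s * (n * Real.log 2) - Real.log ε) / (n * (s * δ / 2)))
  -- `m ≥ n` ensures `n ≤ m < |F| ^ m`, hence enough evaluation points.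
  refine ⟨max n m₁, fun f hf hm => ?_⟩
  set m := f.natDegree with hm'
  have hnm : n ≤ m := (le_max_left _ _).trans hm
  have hm₁m : m₁ ≤ m := (le_max_right _ _).trans hm
  have hm0 : (0 : ℝ) < m := by exact_mod_cast r.den_pos.trans_le hnm
  have hnq : n ≤ Fintype.card F ^ m - 1 := by
    have := Nat.lt_pow_self (n := m) (Fintype.one_lt_card (α := F))
    omega
  obtain ⟨e, a, he, hd⟩ := GRS.exists_frameErrorRate_encode_le W hf hkn' hnq hs0.le
    (by linarith) (haff.trans_lt ENNReal.ofReal_lt_top).ne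
  refine ⟨n, k, e, a, hk0, hkn', hnq, he, ?_, fun d hML => (hd d hML).trans ?_⟩
  · push_cast
    rw [mul_div_mul_right _ _ hm0.ne', ← hkn]
    exact hRr.le
  · have h1 : (((2 ^ n * (Fintype.card F ^ m) ^ k : ℝ≥0) ^ s : ℝ≥0) : ℝ≥0∞) =
        ENNReal.ofReal (Real.exp (s * (n * Real.log 2 + k * (m * Real.log p)))) := by
      rw [← ENNReal.ofReal_coe_nnreal]
      congr 1
      push_cast
      rw [← hp, Real.rpow_def_of_pos (by positivity), Real.log_mul (by positivity) (by positivity),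
        Real.log_pow, Real.log_pow, Real.log_pow, mul_comm s]
    calc _ ≤ ENNReal.ofReal (Real.exp (s * (n * Real.log 2 + k * (m * Real.log p)))) *
          ENNReal.ofReal (Real.exp (-(s * (W.mutualInfo * Real.log p)) + s * δ / 2)) ^ (n * m) := by
          rw [h1]
          gcongr
      -- With `k = r * n`, the rate term and the mutual information term combine to `-m * n * s *
      -- δ`, half of which survives the quadratic error.
      _ = ENNReal.ofReal (Real.exp (s * (n * Real.log 2) - m * (n * (s * δ / 2)))) := by
          rw [← ENNReal.ofReal_pow (Real.exp_pos _).le, ← ENNReal.ofReal_mul (Real.exp_pos _).le,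
            ← Real.exp_nat_mul, ← Real.exp_add, hδ, hkn]
          congr 2
          push_cast
          field_simp
          ring
      _ ≤ ENNReal.ofReal ε := by
          refine ENNReal.ofReal_le_ofReal ?_
          rw [← Real.le_log_iff_exp_le hε]
          have h2 : ((m₁ : ℕ) : ℝ) ≤ m := by exact_mod_cast hm₁m
          have h3 := hm₁.trans h2
          rw [div_le_iff₀ (by positivity)] at h3
          linarith
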